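/- Let $(S_t)_{t\ge 0}$ be a subordinator, possibly killed: a process with values in $[0,\infty]$, with $S_0=0$ and nondecreasing right-continuous paths almost surely, such that for all $s,h\ge 0$, on the event $\{S_s<\infty\}$, the increment $S_{s+h}-S_s$ is independent of $\sigma(S_u: u\le s)$ and distributed as $S_h$. Let $\mathbf d\ge 0$ be its drift and $\nu$ its Lévy measure, a measure on $]0,\infty]$ with $\int \min(1,y)\,\nu(dy)<\infty$, so that with the Laplace exponent $$\Phi(s)=\mathbf d s+\int_{]0,\infty]}\bigl(1-e^{-sy}\bigr)\,\nu(dy)\qquad (s>0,\ e^{-\infty}:=0)$$ one has $\mathbb E\,e^{-\lambda S_t}=e^{-t\Phi(\lambda)}$ for all $t\ge 0$ and $\lambda>0$. Consider the exponential functional and, for $\alpha>0$, its scaled version $$A=\int_0^\infty e^{-S_u}\,du,\qquad L^{(\alpha)}=\int_0^\infty e^{-\alpha S_u}\,du .$$ Then for every $k=0,1,2,\dots$ and every $\alpha>0$, $$\mathbb E A^k=\frac{k!}{\prod_{j=1}^k\Phi(j)},\qquad \mathbb E\bigl(L^{(\alpha)}\bigr)^k=\frac{k!}{\prod_{j=1}^k\Phi(\alpha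 j)} .$$ If $(\mathbf d,\nu)\ne(0,0)$, then $0<\Phi(s)<\infty$ for all $s>0$, so that all these moments are finite; if $(\mathbf d,\nu)=(0,0)$, the formulas hold for $k\ge1$ in the form $\infty=k!/0=\infty$. -/

import Mathlib

open MeasureTheory Set
open scoped ENNReal NNReal Nat

namespace Subordinator

/-- The function `x ↦ e^{-x}` on `[0, ∞]`, with `e^{-∞} = 0`. -/
noncomputable def expNeg (x : ℝ≥0∞) : ℝ≥0∞ := EReal.exp (-(x : EReal))

/-- A Lévy measure of a (possibly killed) subordinator: a Borel measure `ν` on `]0, ∞]` with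
`∫ min(1, y) ν(dy) < ∞`. It is encoded as a measure on `[0, ∞]` that does not charge `0`;
the mass `ν {∞}` is the killing rate. -/
structure IsLevyMeasure (ν : Measure ℝ≥0∞) : Prop where
  zero_mass : ν {0} = 0
  integrable : ∫⁻ y, min 1 y ∂ν < ∞

/-- The function `Φ(s) = s d + ∫_{]0, ∞]} (1 - e^{-s y}) ν(dy)`, for `s > 0`. -/
noncomputable def laplaceExponent (d : ℝ≥0) (ν : Measure ℝ≥0∞) (s : ℝ≥0) : ℝ≥0∞ :=
  s * d + ∫⁻ y, (1 - expNeg (s * y)) ∂ν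

variable {Ω : Type*} [MeasurableSpace Ω]

/-- The past `σ(S_u : u ≤ s)` of the process at time `s`. -/
@[reducible] def past (S : ℝ≥0 → Ω → ℝ≥0∞) (s : ℝ≥0) : MeasurableSpace Ω :=
  ⨆ u : Iic s, MeasurableSpace.comap (S u) inferInstance

/-- A (possibly killed) subordinator under `P`: a process with values in `[0, ∞]`, started at `0`,
with nondecreasing right-continuous paths, such that for all `s, h ≥ 0`, on the event
`S_s < ∞`, the increment `S_{s+h} - S_s` is independent of the past up to time `s` and distributed
as `S_h`. If `S` never reaches `∞`, this says that the increments are independent and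
stationary. -/
structure IsSubordinator (P : Measure Ω) (S : ℝ≥0 → Ω → ℝ≥0∞) : Prop where
  measurable : ∀ t, Measurable (S t)
  start : ∀ᵐ ω ∂P, S 0 ω = 0
  mono : ∀ᵐ ω ∂P, Monotone fun t => S t ω
  right_cont : ∀ᵐ ω ∂P, ∀ t, ContinuousWithinAt (fun u => S u ω) (Ici t) t
  increments : ∀ (s h : ℝ≥0) (F : Set Ω) (B : Set ℝ≥0∞),
    MeasurableSet[past S s] F → MeasurableSet B →
      P (F ∩ {ω | S s ω < ∞} ∩ {ω | S (s + h) ω - S s ω ∈ B}) =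
        P (F ∩ {ω | S s ω < ∞}) * P {ω | S h ω ∈ B}

/-- `S` has drift `d` and Lévy measure `ν`, that is, `Φ` is its Laplace exponent:
`E e^{-λ S_t} = e^{-t Φ(λ)}` for all `t ≥ 0` and `λ > 0`. -/
def HasLevyData (P : Measure Ω) (S : ℝ≥0 → Ω → ℝ≥0∞) (d : ℝ≥0) (ν : Measure ℝ≥0∞) : Prop :=
  ∀ (t r : ℝ≥0), 0 < r →
    ∫⁻ ω, expNeg (r * S t ω) ∂P = expNeg (t * laplaceExponent d ν r)

/-- The exponential functional `∫_0^∞ e^{-S_u} du` of a process. -/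
noncomputable def expFunctional (S : ℝ≥0 → Ω → ℝ≥0∞) (ω : Ω) : ℝ≥0∞ :=
  ∫⁻ u in Ioi (0 : ℝ), expNeg (S u.toNNReal ω)

/-- The functional `L^{(α)} = ∫_0^∞ e^{-α S_u} du`: the exponential functional of the process
`(α S_t)`. -/
noncomputable def scaledExpFunctional (α : ℝ≥0) (S : ℝ≥0 → Ω → ℝ≥0∞) : Ω → ℝ≥0∞ :=
  expFunctional fun t ω => α * S t ω

end Subordinator

namespace Subordinator

/-! By symmetry the k-th power of `∫ f` over a half-line is `k!` times the integral over ordered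
points `u₁ < ⋯ < u_k`, here `f u = e^{-α S_u}`. Peeling off the smallest point gives the recursion
of `iteratedTail`.

Let `G_k(t)` be this tail and `Z` depend only on the past of `t`. Induction on `k` gives `E[Z
G_k(t)] = E[Z e^{-αk S_t}] ∏_{j≤k} Φ(αj)⁻¹`. The hypothesis at time `u > t` with weight `Z e^{-α
S_u}` produces `e^{-α(k+1) S_u}`; independence of the increment replaces it by `e^{-α(k+1) S_t}
e^{-(u-t) Φ(α(k+1))}`, and integrating over `u` gives the new factor. Take `t = 0`, `Z = 1`.
Everything lives in `[0, ∞]`, so infinite moments need no separate argument. -/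

lemma expNeg_add (x y : ℝ≥0∞) : expNeg (x + y) = expNeg x * expNeg y := by
  rw [expNeg, EReal.coe_ennreal_add, EReal.neg_add (.inl (EReal.coe_ennreal_ne_bot _))
    (.inr (EReal.coe_ennreal_ne_bot _)), sub_eq_add_neg, EReal.exp_add]
  rfl

@[simp] lemma expNeg_zero : expNeg 0 = 1 := by simp [expNeg]

@[simp] lemma expNeg_top : expNeg ∞ = 0 := by simp [expNeg]

lemma expNeg_ofReal {x : ℝ} (hx : 0 ≤ x) :
    expNeg (ENNReal.ofReal x) = ENNReal.ofReal (Real.exp (-x)) := by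
  rw [expNeg, EReal.coe_ennreal_ofReal, max_eq_left hx, ← EReal.coe_neg, EReal.exp_coe]

lemma expNeg_lt_one {x : ℝ≥0∞} (hx : x ≠ 0) : expNeg x < 1 := by
  rw [expNeg, EReal.exp_lt_one_iff, EReal.neg_lt_zero]
  exact EReal.coe_ennreal_pos.2 (pos_iff_ne_zero.2 hx)

lemma one_sub_expNeg_le (x : ℝ≥0∞) : 1 - expNeg x ≤ x := by
  induction x with
  | top => exact le_top
  | coe x =>
    rw [← ENNReal.ofReal_coe_nnreal, expNeg_ofReal x.coe_nonneg, ← ENNReal.ofReal_one,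
      ← ENNReal.ofReal_sub _ (Real.exp_pos _).le]
    exact ENNReal.ofReal_le_ofReal (by linarith [Real.add_one_le_exp (-(x : ℝ))])

lemma measurable_expNeg : Measurable expNeg := by
  unfold expNeg
  exact (measurable_coe_ennreal_ereal.neg).ereal_exp

lemma lintegral_expNeg_mul_Ioi {c : ℝ≥0∞} (hc : c ≠ ∞) (t : ℝ) :
    ∫⁻ u in Ioi t, expNeg (ENNReal.ofReal (u - t) * c) = c⁻¹ := by
  lift c to ℝ≥0 using hc
  rcases eq_or_ne c 0 with rfl | h0
  -- Both sides are `∞`; this covers a vanishing Laplace exponent.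
  · simp
  have hpos : (0 : ℝ) < c := by exact_mod_cast pos_iff_ne_zero.2 h0
  have hi : IntegrableOn (fun u : ℝ => Real.exp (-c * u)) (Ioi t) :=
    integrableOn_exp_mul_Ioi (by linarith) t
  have h1 : ∀ u ∈ Ioi t, expNeg (ENNReal.ofReal (u - t) * c) =
      ENNReal.ofReal (Real.exp (c * t)) * ENNReal.ofReal (Real.exp (-c * u)) := by
    intro u hu
    have hu' : 0 ≤ u - t := sub_nonneg.2 (le_of_lt hu)
    rw [← ENNReal.ofReal_coe_nnreal, ← ENNReal.ofReal_mul hu', expNeg_ofReal (by positivity),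
      ← ENNReal.ofReal_mul (Real.exp_pos _).le, ← Real.exp_add]
    congr 2
    ring
  rw [setLIntegral_congr_fun measurableSet_Ioi h1, lintegral_const_mul' _ _ ENNReal.ofReal_ne_top,
    ← ofReal_integral_eq_lintegral_ofReal hi (.of_forall fun _ => (Real.exp_pos _).le),
    integral_exp_mul_Ioi (by linarith), ← ENNReal.ofReal_mul (Real.exp_pos _).le,
    ← ENNReal.ofReal_coe_nnreal, ← ENNReal.ofReal_inv_of_pos hpos]
  congr 1
  rw [neg_div_neg_eq, ← mul_div_assoc, ← Real.exp_add]
  simp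

/-! ### Powers of an integral as ordered integrals -/

/-- The iterated tail integrals `∫_{t < u₁ < ⋯ < u_k} f(u₁) ⋯ f(u_k) du`. -/
noncomputable def iteratedTail (f : ℝ → ℝ≥0∞) : ℕ → ℝ → ℝ≥0∞
  | 0, _ => 1
  | k + 1, t => ∫⁻ u in Ioi t, f u * iteratedTail f k u

lemma measurable_iteratedTail {Ω : Type*} [MeasurableSpace Ω] {f : Ω → ℝ → ℝ≥0∞}
    (hf : Measurable (Function.uncurry f)) (k : ℕ) :
    Measurable (Function.uncurry fun ω t => iteratedTail (f ω) k t) := by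
  induction k with
  | zero => exact measurable_const
  | succ k ih =>
    have h : (Function.uncurry fun ω t => iteratedTail (f ω) (k + 1) t) = fun p : Ω × ℝ =>
        ∫⁻ u, {q : (Ω × ℝ) × ℝ | q.1.2 < q.2}.indicator
          (fun q => f q.1.1 q.2 * iteratedTail (f q.1.1) k q.2) (p, u) := by
      ext p
      simp only [Function.uncurry, iteratedTail]
      rw [← lintegral_indicator measurableSet_Ioi]
      rfl
    rw [h]
    refine Measurable.lintegral_prod_right' (Measurable.indicator ?_ ?_)
    · exact (hf.comp (g := Function.uncurry f) (f := fun q : (Ω × ℝ) × ℝ => (q.1.1, q.2))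
        (by fun_prop)).mul (ih.comp (f := fun q : (Ω × ℝ) × ℝ => (q.1.1, q.2)) (by fun_prop))
    · exact measurableSet_lt (by fun_prop) (by fun_prop)

lemma measurable_iteratedTail_apply {f : ℝ → ℝ≥0∞} (hf : Measurable f) (k : ℕ) :
    Measurable (iteratedTail f k) := by
  have h := measurable_iteratedTail (Ω := Unit) (f := fun _ => f) (hf.comp measurable_snd) k
  exact h.comp (measurable_prodMk_left (x := ()))

lemma lintegral_Ioi_mul_lintegral_Ioc {f g : ℝ → ℝ≥0∞} (hf : Measurable f) (hg : Measurable g)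
    (t : ℝ) :
    ∫⁻ v in Ioi t, g v * ∫⁻ u in Ioc t v, f u = ∫⁻ u in Ioi t, f u * ∫⁻ v in Ioi u, g v := by
  have h1 : ∀ v, g v * ∫⁻ u in Ioc t v, f u =
      ∫⁻ u in Ioi t, {p : ℝ × ℝ | p.2 ≤ p.1}.indicator (fun p => g p.1 * f p.2) (v, u) := by
    intro v
    rw [← lintegral_const_mul _ hf, ← Ioi_inter_Iic, inter_comm,
      ← Measure.restrict_restrict measurableSet_Iic, ← lintegral_indicator measurableSet_Iic]
    rfl
  have h2 : ∀ u ∈ Ioi t, f u * ∫⁻ v in Ioi u, g v =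
      ∫⁻ v in Ioi t, {p : ℝ × ℝ | p.2 ≤ p.1}.indicator (fun p => g p.1 * f p.2) (v, u) := by
    intro u hu
    -- Closing the half-line costs a null set and makes both sides integrals over the same region `u
    -- ≤ v`.
    rw [← lintegral_const_mul _ hg, setLIntegral_congr Ioi_ae_eq_Ici,
      ← inter_eq_left.2 (Ici_subset_Ioi.2 hu),
      ← Measure.restrict_restrict measurableSet_Ici, ← lintegral_indicator measurableSet_Ici]
    refine lintegral_congr fun v => ?_
    simp only [indicator, mem_Ici, mem_ofPred_eq, mul_comm]
  simp_rw [h1]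
  rw [setLIntegral_congr_fun measurableSet_Ioi h2, lintegral_lintegral_swap]
  exact (Measurable.indicator (by fun_prop)
    (measurableSet_le measurable_snd measurable_fst)).aemeasurable

/-- An extra point fits into `k + 1` positions among `k` ordered ones. In the induction it falls
either before the smallest point `v` (Tonelli) or after it (hypothesis at `v`). -/
lemma lintegral_mul_iteratedTail {f : ℝ → ℝ≥0∞} (hf : Measurable f) (k : ℕ) (t : ℝ) :
    (∫⁻ u in Ioi t, f u) * iteratedTail f k t = (k + 1) * iteratedTail f (k + 1) t := by
  induction k generalizing t with
  | zero => simp [iteratedTail]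
  | succ k ih =>
    have hG := measurable_iteratedTail_apply hf
    have h1 : ∀ v ∈ Ioi t, (∫⁻ u in Ioi t, f u) * (f v * iteratedTail f k v) =
        f v * iteratedTail f k v * (∫⁻ u in Ioc t v, f u) +
          (k + 1) * (f v * iteratedTail f (k + 1) v) := by
      intro v hv
      rw [← Ioc_union_Ioi_eq_Ioi (le_of_lt hv), lintegral_union measurableSet_Ioi
        (disjoint_left.2 fun x hx hx' => not_lt.2 hx.2 hx'), mul_left_comm _ (f v) (iteratedTail f (k + 1) v),
        ← ih v]
      ring
    rw [iteratedTail, ← lintegral_const_mul _ (by exact hf.mul (hG k)),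
      setLIntegral_congr_fun measurableSet_Ioi h1,
      lintegral_add_right _ (by exact (hf.mul (hG (k + 1))).const_mul _),
      lintegral_Ioi_mul_lintegral_Ioc (g := fun v => f v * iteratedTail f k v) hf
        (hf.mul (hG k)),
      lintegral_const_mul _ (by exact hf.mul (hG (k + 1)))]
    simp only [iteratedTail]
    push_cast
    ring

lemma lintegral_pow_eq_iteratedTail {f : ℝ → ℝ≥0∞} (hf : Measurable f) (k : ℕ) (t : ℝ) :
    (∫⁻ u in Ioi t, f u) ^ k = k ! * iteratedTail f k t := by
  induction k with
  | zero => simp [iteratedTail]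
  | succ k ih =>
    rw [pow_succ', ih, mul_left_comm, lintegral_mul_iteratedTail hf, Nat.factorial_succ]
    push_cast
    ring

/-! ### Finiteness and positivity of the Laplace exponent -/

lemma laplaceExponent_lt_top {ν : Measure ℝ≥0∞} (hν : IsLevyMeasure ν) (d s : ℝ≥0) :
    laplaceExponent d ν s < ∞ := by
  refine ENNReal.add_lt_top.2 ⟨ENNReal.mul_lt_top ENNReal.coe_lt_top ENNReal.coe_lt_top, ?_⟩
  have hle : ∀ y, 1 - expNeg (s * y) ≤ ((max 1 s : ℝ≥0) : ℝ≥0∞) * min 1 y := by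
    intro y
    have h1 : (1 : ℝ≥0∞) ≤ ((max 1 s : ℝ≥0) : ℝ≥0∞) := by exact_mod_cast le_max_left _ _
    have h2 : (s : ℝ≥0∞) ≤ ((max 1 s : ℝ≥0) : ℝ≥0∞) := by exact_mod_cast le_max_right _ _
    rcases le_total 1 y with hy | hy
    · rw [min_eq_left hy, mul_one]
      exact tsub_le_self.trans h1
    · rw [min_eq_right hy]
      exact (one_sub_expNeg_le _).trans (by gcongr)
  refine (lintegral_mono hle).trans_lt ?_
  rw [lintegral_const_mul' _ _ ENNReal.coe_ne_top]
  exact ENNReal.mul_lt_top ENNReal.coe_lt_top hν.integrable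

lemma laplaceExponent_pos {ν : Measure ℝ≥0∞} (hν : IsLevyMeasure ν) {d s : ℝ≥0} (hs : 0 < s)
    (h : d ≠ 0 ∨ ν ≠ 0) : 0 < laplaceExponent d ν s := by
  refine pos_iff_ne_zero.2 fun h0 => ?_
  have hm : Measurable fun y : ℝ≥0∞ => 1 - expNeg (s * y) :=
    measurable_const.sub (measurable_expNeg.comp (measurable_id.const_mul _))
  rw [laplaceExponent, add_eq_zero, mul_eq_zero, lintegral_eq_zero_iff hm] at h0
  obtain ⟨h1, h2⟩ := h0
  rcases h with hd | hn
  · simp [hs.ne', hd] at h1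
  · refine hn (Measure.measure_univ_eq_zero.1 (le_antisymm ?_ zero_le))
    have hae : ∀ᵐ y ∂ν, y = 0 := by
      filter_upwards [h2] with y hy
      by_contra hne
      have hne' : (s : ℝ≥0∞) * y ≠ 0 := mul_ne_zero (by simpa using hs.ne') hne
      exact absurd (tsub_eq_zero_iff_le.1 hy) (not_le.2 (expNeg_lt_one hne'))
    calc ν univ ≤ ν ({0} ∪ {y | ¬ y = 0}) := measure_mono fun y _ => em (y = 0)
      _ ≤ ν {0} + ν {y | ¬ y = 0} := measure_union_le _ _
      _ = 0 := by rw [hν.zero_mass, ae_iff.1 hae, add_zero]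

/-! ### Independence of increments from the past -/

lemma measurable_past {Ω : Type*} {S : ℝ≥0 → Ω → ℝ≥0∞} {u s : ℝ≥0} (h : u ≤ s) :
    Measurable[past S s] (S u) :=
  Measurable.of_comap_le (le_iSup (fun u : Iic s => MeasurableSpace.comap (S u) inferInstance)
    ⟨u, h⟩)

lemma past_mono {Ω : Type*} {S : ℝ≥0 → Ω → ℝ≥0∞} {s t : ℝ≥0} (h : s ≤ t) :
    past S s ≤ past S t :=
  iSup_le fun u => (measurable_past (u.2.trans h)).comap_le

section

variable {Ω : Type*} [MeasurableSpace Ω] {P : Measure Ω} {S : ℝ≥0 → Ω → ℝ≥0∞}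

lemma IsSubordinator.past_le (hS : IsSubordinator P S) (s : ℝ≥0) :
    past S s ≤ ‹MeasurableSpace Ω› :=
  iSup_le fun u => (hS.measurable u).comap_le

/-- The increment of a subordinator is independent of the past, in terms of integrals. -/
lemma IsSubordinator.lintegral_mul_increment [IsProbabilityMeasure P] (hS : IsSubordinator P S)
    (s h : ℝ≥0) {Z : Ω → ℝ≥0∞} (hZ : Measurable[past S s] Z) {f : ℝ≥0∞ → ℝ≥0∞}
    (hf : Measurable f) :
    ∫⁻ ω in {ω | S s ω < ∞}, Z ω * f (S (s + h) ω - S s ω) ∂P =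
      (∫⁻ ω in {ω | S s ω < ∞}, Z ω ∂P) * ∫⁻ ω, f (S h ω) ∂P := by
  have hX : Measurable fun ω => S (s + h) ω - S s ω := (hS.measurable _).sub (hS.measurable _)
  set Q := P.restrict {ω | S s ω < ∞} with hQ
  have hfin : MeasurableSet {ω | S s ω < ∞} := measurableSet_lt (hS.measurable s) measurable_const
  have key : ∀ F, MeasurableSet[past S s] F →
      ∫⁻ ω in F, f (S (s + h) ω - S s ω) ∂Q = Q F * ∫⁻ ω, f (S h ω) ∂P := by
    intro F hF
    have hF' := hS.past_le s F hF
    have hmap : (Q.restrict F).map (fun ω => S (s + h) ω - S s ω) = Q F • P.map (S h) := by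
      ext B hB
      rw [Measure.map_apply hX hB, Measure.restrict_apply (hX hB), Measure.smul_apply,
        Measure.map_apply (hS.measurable h) hB, hQ, Measure.restrict_apply ((hX hB).inter hF'),
        Measure.restrict_apply hF', smul_eq_mul]
      have := hS.increments s h F B hF hB
      change _ = _ * P (S h ⁻¹' B) at this
      rw [← this, inter_comm _ F, inter_right_comm]
      rfl
    rw [← lintegral_map hf hX, hmap, lintegral_smul_measure, lintegral_map hf (hS.measurable h),
      smul_eq_mul]
  have hm := hS.past_le s
  -- `key` identifies two measures on the past only, so both are trimmed to it; this suffices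
  -- because `Z` is past-measurable.
  have htrim : (Q.withDensity fun ω => f (S (s + h) ω - S s ω)).trim hm =
      (∫⁻ ω, f (S h ω) ∂P) • Q.trim hm := by
    refine @Measure.ext _ (past S s) _ _ fun F hF => ?_
    rw [trim_measurableSet_eq hm hF, withDensity_apply _ (hm F hF), key F hF, Measure.smul_apply,
      trim_measurableSet_eq hm hF, smul_eq_mul, mul_comm]
  have hfX : Measurable fun ω => f (S (s + h) ω - S s ω) := hf.comp hX
  calc ∫⁻ ω, Z ω * f (S (s + h) ω - S s ω) ∂Q
      = ∫⁻ ω, Z ω ∂(Q.withDensity fun ω => f (S (s + h) ω - S s ω)) := by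
        rw [lintegral_withDensity_eq_lintegral_mul _ hfX (hZ.mono hm le_rfl)]
        simp only [Pi.mul_apply, mul_comm]
    _ = (∫⁻ ω, Z ω ∂Q) * ∫⁻ ω, f (S h ω) ∂P := by
        rw [← lintegral_trim hm hZ, htrim, lintegral_smul_measure, lintegral_trim hm hZ,
          smul_eq_mul, mul_comm]

lemma IsSubordinator.lintegral_mul_expNeg [IsProbabilityMeasure P] (hS : IsSubordinator P S)
    {d : ℝ≥0} {ν : Measure ℝ≥0∞} (hdata : HasLevyData P S d ν) (s h : ℝ≥0) {r : ℝ≥0} (hr : 0 < r)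
    {Z : Ω → ℝ≥0∞} (hZ : Measurable[past S s] Z) :
    ∫⁻ ω, Z ω * expNeg (r * S (s + h) ω) ∂P =
      (∫⁻ ω, Z ω * expNeg (r * S s ω) ∂P) * expNeg (h * laplaceExponent d ν r) := by
  have hfin : MeasurableSet {ω | S s ω < ∞} := measurableSet_lt (hS.measurable s) measurable_const
  have hr' : (r : ℝ≥0∞) ≠ 0 := by simpa using hr.ne'
  have hexp : Measurable fun x : ℝ≥0∞ => expNeg (r * x) :=
    measurable_expNeg.comp (measurable_id.const_mul _)
  -- Paths already at `∞` stay there and contribute `e^{-∞} = 0`, so the increment is needed only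
  -- where it is controlled.
  have hrestrict : ∀ h : ℝ≥0, ∫⁻ ω, Z ω * expNeg (r * S (s + h) ω) ∂P =
      ∫⁻ ω in {ω | S s ω < ∞}, Z ω * expNeg (r * S (s + h) ω) ∂P := by
    intro h
    rw [← lintegral_indicator hfin]
    refine lintegral_congr_ae ?_
    filter_upwards [hS.mono] with ω hω
    by_cases hs : S s ω < ∞
    · rw [indicator_of_mem (s := {ω | S s ω < ∞}) hs]
    · have : S (s + h) ω = ∞ :=
        top_le_iff.1 ((not_lt_top_iff.1 hs).symm.le.trans (hω le_self_add))
      rw [indicator_of_notMem (s := {ω | S s ω < ∞}) hs, this, ENNReal.mul_top hr', expNeg_top,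
        mul_zero]
  have h0 := hrestrict 0
  rw [add_zero] at h0
  rw [hrestrict h, h0, ← hdata h r hr,
    ← hS.lintegral_mul_increment s h (Z := fun ω => Z ω * expNeg (r * S s ω))
      (hZ.mul (hexp.comp (measurable_past le_rfl))) hexp]
  refine lintegral_congr_ae ?_
  filter_upwards [ae_restrict_of_ae hS.mono] with ω hω
  rw [mul_assoc, ← expNeg_add, ← mul_add, add_tsub_cancel_of_le (hω le_self_add)]

/-- A right-continuous process has a jointly measurable version. -/
lemma IsSubordinator.exists_measurable_version (hS : IsSubordinator P S) :
    ∃ T : ℝ≥0 → Ω → ℝ≥0∞, Measurable (Function.uncurry T) ∧ ∀ᵐ ω ∂P, ∀ u, T u ω = S u ω := by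
  -- The right end of the grid cell of mesh `1/(n+1)` containing `u`: it takes countably many values
  -- and tends to `u` from the right.
  let a : ℕ → ℝ≥0 → ℝ≥0 := fun n u => ((⌊((n : ℝ≥0) + 1) * u⌋₊ : ℝ≥0) + 1) / ((n : ℝ≥0) + 1)
  refine ⟨fun u ω => Filter.liminf (fun n => S (a n u) ω) Filter.atTop, ?_, ?_⟩
  · refine Measurable.liminf (f := fun n (p : ℝ≥0 × Ω) => S (a n p.1) p.2) fun n => ?_
    have hc : Measurable fun q : ℕ × Ω => S (((q.1 : ℝ≥0) + 1) / ((n : ℝ≥0) + 1)) q.2 :=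
      measurable_from_prod_countable_right fun m => hS.measurable (((m : ℝ≥0) + 1) / ((n : ℝ≥0) + 1))
    exact hc.comp (f := fun p : ℝ≥0 × Ω => (⌊((n : ℝ≥0) + 1) * p.1⌋₊, p.2))
      ((Nat.measurable_floor.comp (measurable_fst.const_mul _)).prodMk measurable_snd)
  · filter_upwards [hS.right_cont] with ω hω u
    have hle : ∀ n, u ≤ a n u := fun n => by
      rw [le_div_iff₀ (by positivity), mul_comm]
      exact (Nat.lt_floor_add_one _).le
    have hge : ∀ n, a n u ≤ u + 1 / ((n : ℝ≥0) + 1) := fun n => by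
      rw [div_le_iff₀ (by positivity), add_mul u, div_mul_cancel₀ _ (by positivity), mul_comm u]
      gcongr
      exact Nat.floor_le zero_le
    have hlim : Filter.Tendsto (fun n : ℕ => u + 1 / ((n : ℝ≥0) + 1)) Filter.atTop (nhds u) := by
      simpa using (tendsto_one_div_add_atTop_nhds_zero_nat (𝕜 := ℝ≥0)).const_add u
    have ha : Filter.Tendsto (fun n => a n u) Filter.atTop (nhdsWithin u (Ici u)) :=
      tendsto_nhdsWithin_iff.2 ⟨tendsto_of_tendsto_of_tendsto_of_le_of_le tendsto_const_nhds hlim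
        hle hge, .of_forall hle⟩
    exact ((hω u).tendsto.comp ha).liminf_eq

/-! ### Moments of the exponential functional -/

lemma IsSubordinator.lintegral_mul_iteratedTail [IsProbabilityMeasure P] (hS : IsSubordinator P S)
    {d : ℝ≥0} {ν : Measure ℝ≥0∞} (hν : IsLevyMeasure ν) (hdata : HasLevyData P S d ν)
    {T : ℝ≥0 → Ω → ℝ≥0∞} (hT : Measurable (Function.uncurry T))
    (hTS : ∀ᵐ ω ∂P, ∀ u, T u ω = S u ω) {α : ℝ≥0} (hα : 0 < α) (k : ℕ) {t : ℝ} (ht : 0 ≤ t)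
    {Z : Ω → ℝ≥0∞} (hZ : Measurable[past S t.toNNReal] Z) :
    ∫⁻ ω, Z ω * iteratedTail (fun u => expNeg (α * T u.toNNReal ω)) k t ∂P =
      (∫⁻ ω, Z ω * expNeg ((α * k : ℝ≥0) * S t.toNNReal ω) ∂P) *
        ∏ j ∈ Finset.Icc 1 k, (laplaceExponent d ν (α * (j : ℝ≥0)))⁻¹ := by
  induction k generalizing t Z with
  | zero => simp [iteratedTail]
  | succ k ih =>
    have hf : Measurable (Function.uncurry fun ω (u : ℝ) => expNeg (α * T u.toNNReal ω)) :=
      measurable_expNeg.comp (Measurable.const_mul (hT.comp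
        (f := fun p : Ω × ℝ => (p.2.toNNReal, p.1)) (by fun_prop)) _)
    have hfG := hf.mul (measurable_iteratedTail hf k)
    have hZ' : Measurable Z := hZ.mono (hS.past_le _) le_rfl
    have hexp : Measurable fun x : ℝ≥0∞ => expNeg (α * x) :=
      measurable_expNeg.comp (measurable_id.const_mul _)
    have hpos : 0 < α * ((k + 1 : ℕ) : ℝ≥0) := by positivity
    set C := ∏ j ∈ Finset.Icc 1 k, (laplaceExponent d ν (α * (j : ℝ≥0)))⁻¹
    set c := laplaceExponent d ν (α * ((k + 1 : ℕ) : ℝ≥0))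
    set M := ∫⁻ ω, Z ω * expNeg ((α * (k + 1 : ℕ) : ℝ≥0) * S t.toNNReal ω) ∂P
    have hstep : ∀ u ∈ Ioi t, ∫⁻ ω, Z ω * (expNeg (α * T u.toNNReal ω) *
        iteratedTail (fun u => expNeg (α * T u.toNNReal ω)) k u) ∂P =
          M * C * expNeg (ENNReal.ofReal (u - t) * c) := by
      intro u hu
      have htu : t ≤ u := le_of_lt hu
      have hadd : u.toNNReal = t.toNNReal + (u - t).toNNReal := by
        rw [← Real.toNNReal_add ht (sub_nonneg.2 htu), add_sub_cancel]
      -- The version `T` serves Tonelli, but it is built from values of `S` after time `u`; the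
      -- weight must use `S` to be past-measurable.
      calc _ = ∫⁻ ω, (Z ω * expNeg (α * S u.toNNReal ω)) *
            iteratedTail (fun u => expNeg (α * T u.toNNReal ω)) k u ∂P := by
            refine lintegral_congr_ae ?_
            filter_upwards [hTS] with ω hω
            rw [hω u.toNNReal, mul_assoc]
        _ = (∫⁻ ω, (Z ω * expNeg (α * S u.toNNReal ω)) *
              expNeg ((α * k : ℝ≥0) * S u.toNNReal ω) ∂P) * C :=
            ih (ht.trans htu) ((hZ.mono (past_mono (Real.toNNReal_mono htu)) le_rfl).mul
              (hexp.comp (measurable_past le_rfl)))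
        _ = (∫⁻ ω, Z ω * expNeg ((α * (k + 1 : ℕ) : ℝ≥0) *
              S (t.toNNReal + (u - t).toNNReal) ω) ∂P) * C := by
            congr 1
            refine lintegral_congr fun ω => ?_
            rw [mul_assoc, ← expNeg_add, ← hadd, ← add_mul]
            congr 3
            push_cast
            ring
        _ = M * C * expNeg (ENNReal.ofReal (u - t) * c) := by
            rw [hS.lintegral_mul_expNeg hdata _ _ hpos hZ, mul_right_comm]
            rfl
    calc _ = ∫⁻ ω, (∫⁻ u in Ioi t, Z ω * (expNeg (α * T u.toNNReal ω) *
            iteratedTail (fun u => expNeg (α * T u.toNNReal ω)) k u)) ∂P := by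
          refine lintegral_congr fun ω => ?_
          rw [iteratedTail, lintegral_const_mul]
          exact hfG.comp (measurable_prodMk_left (x := ω))
      _ = ∫⁻ u in Ioi t, ∫⁻ ω, Z ω * (expNeg (α * T u.toNNReal ω) *
            iteratedTail (fun u => expNeg (α * T u.toNNReal ω)) k u) ∂P :=
          lintegral_lintegral_swap ((hZ'.comp measurable_fst).mul hfG).aemeasurable
      _ = M * C * c⁻¹ := by
          have hm : Measurable fun u : ℝ => expNeg (ENNReal.ofReal (u - t) * c) :=
            measurable_expNeg.comp (by fun_prop)
          rw [setLIntegral_congr_fun measurableSet_Ioi hstep, lintegral_const_mul _ hm,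
            lintegral_expNeg_mul_Ioi (laplaceExponent_lt_top hν _ _).ne]
      _ = _ := by
          rw [Finset.prod_Icc_succ_top (by omega), mul_assoc]

theorem IsSubordinator.lintegral_scaledExpFunctional_pow [IsProbabilityMeasure P]
    (hS : IsSubordinator P S) {d : ℝ≥0} {ν : Measure ℝ≥0∞} (hν : IsLevyMeasure ν)
    (hdata : HasLevyData P S d ν) {α : ℝ≥0} (hα : 0 < α) (k : ℕ) :
    ∫⁻ ω, scaledExpFunctional α S ω ^ k ∂P =
      (k ! : ℝ≥0∞) / ∏ j ∈ Finset.Icc 1 k, laplaceExponent d ν (α * (j : ℝ≥0)) := by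
  obtain ⟨T, hT, hTS⟩ := hS.exists_measurable_version
  have hmain := hS.lintegral_mul_iteratedTail hν hdata hT hTS hα k le_rfl
    (Z := fun _ => 1) measurable_const
  have hone : ∫⁻ ω, 1 * expNeg ((α * k : ℝ≥0) * S (0 : ℝ).toNNReal ω) ∂P = 1 := by
    rw [← measure_univ (μ := P), ← lintegral_one]
    refine lintegral_congr_ae ?_
    filter_upwards [hS.start] with ω hω
    simp [hω]
  rw [hone, one_mul] at hmain
  simp only [one_mul] at hmain
  have hpow : ∀ᵐ ω ∂P, scaledExpFunctional α S ω ^ k =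
      k ! * iteratedTail (fun u => expNeg (α * T u.toNNReal ω)) k 0 := by
    filter_upwards [hTS] with ω hω
    have hf : Measurable fun u : ℝ => expNeg (α * T u.toNNReal ω) :=
      measurable_expNeg.comp (Measurable.const_mul (hT.comp
        (f := fun u : ℝ => (u.toNNReal, ω)) (by fun_prop)) _)
    rw [← lintegral_pow_eq_iteratedTail hf]
    simp only [scaledExpFunctional, expFunctional, hω]
  rw [lintegral_congr_ae hpow, lintegral_const_mul' _ _ (ENNReal.natCast_ne_top _), hmain,
    div_eq_mul_inv, ENNReal.prod_inv_distrib]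
  intro i _ j _ _
  -- Finite factors exclude `0 * ∞`, so inversion commutes with the product.
  exact Or.inr (laplaceExponent_lt_top hν _ _).ne

end

end Subordinator

theorem mainTheorem9 {Ω : Type*} [MeasurableSpace Ω] (P : Measure Ω) [IsProbabilityMeasure P]
    (S : ℝ≥0 → Ω → ℝ≥0∞) (d : ℝ≥0) (ν : Measure ℝ≥0∞)
    (hν : Subordinator.IsLevyMeasure ν)
    (hS : Subordinator.IsSubordinator P S)
    (hdata : Subordinator.HasLevyData P S d ν) :
    (∀ k : ℕ, ∫⁻ ω, Subordinator.expFunctional S ω ^ k ∂P =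
      (k ! : ℝ≥0∞) / ∏ j ∈ Finset.Icc 1 k, Subordinator.laplaceExponent d ν (j : ℝ≥0)) ∧
    (∀ α : ℝ≥0, 0 < α → ∀ k : ℕ,
      ∫⁻ ω, Subordinator.scaledExpFunctional α S ω ^ k ∂P =
        (k ! : ℝ≥0∞) /
          ∏ j ∈ Finset.Icc 1 k, Subordinator.laplaceExponent d ν (α * (j : ℝ≥0))) ∧
    -- if the subordinator is not identically zero, these moments are finite
    ((d ≠ 0 ∨ ν ≠ 0) → ∀ s : ℝ≥0, 0 < s →
      0 < Subordinator.laplaceExponent d ν s ∧ Subordinator.laplaceExponent d ν s < ∞) := by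
  refine ⟨fun k => ?_, fun α hα k => hS.lintegral_scaledExpFunctional_pow hν hdata hα k,
    fun h s hs => ⟨Subordinator.laplaceExponent_pos hν hs h,
      Subordinator.laplaceExponent_lt_top hν d s⟩⟩
  simpa [Subordinator.scaledExpFunctional] using
    hS.lintegral_scaledExpFunctional_pow hν hdata one_pos k
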